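/- **Theorem.** Let $Q$ be a totally ordered set and $P\subseteq Q$ a final segment such that either $P=Q$ or $P=\{x\in Q: x\ge q\}$ for some $q\in Q$. Then there are an ordered abelian group $G$ and a derivation $D$ of Hardy type on the field $K=\mathbb R((G))$ of generalized power series (with its usual order, $a<b$ iff $a_g<b_g$ at the least $g$ with $a_g\ne b_g$, and its valuation $v(a)=\min\operatorname{supp}(a)$) such that the H-field $(K,\le,D)$ has principal differential rank $P$ and principal unfolded differential rank $Q$. More precisely, there are order isomorphisms $e$ from $Q$ onto the principal unfolded differential rank and $f$ from $P$ onto the principal differential rank such that, for all $p\in P$, $e(p)$ is the convex subgroup $G_{f(p)}=v(\mathcal O_{f(p)}^{\times})$ of $G$ attached to the coarsening $f(p)$ of $v$. **Definitions.** Let $C=\ker D$, $\mathcal O_v=\{a: v(a)\ge 0\}$, $\mathfrak m_v=\{a: v(a)>0\}$. *H-field (with valuation $v$):* $\mathcal O_v=\{a:\exists c\in C,\ |a|\le c\}$ is convex; $\mathcal O_v=C+\mathfrak m_v$; $v(D(a))>v(D(b)/b)$ whenever $a\in\mathcal O_v$ and $0\neq b\in\mathfrak m_v$; and $D(a)>0$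 whenever $a>\mathcal O_v$. Its *asymptotic couple* is $(G,\psi)$ with $\psi:G\setminus\{0\}\to G$, $\psi(v(a))=v(D(a)/a)$. *Hardy type:* $D$ is of Hardy type if $(K,\le,D)$ is an H-field with valuation $v$ and, for nonzero elements of $G$ and with the convention $\psi(0)=\infty$: $\psi(g+h)\ge\min(\psi(g),\psi(h))$; $\psi(ng)=\psi(g)$ for integers $n\ne0$; $\psi(g)<\psi(h)+|h|$; $g\le h<0$ implies $\psi(g)\le\psi(h)$; and $\psi(g)=\psi(h)$ implies that $g,h$ are archimedean-equivalent. *Compatibility:* a subset $B$ of a set is compatible with a partial map $\phi$ if $a\in B\Leftrightarrow\phi(a)\in B$ for all $a\in\operatorname{dom}\phi$. *Principal differential rank:* let $\phi(a)=D(a)/a$ for $a\neq0$ with $v(a)\ne0$. The principal differential rank is the order type, under inclusion of valuation rings, of the set of valuation rings $\mathcal O_w\supsetneq\mathcal O_v$ of $K$ such that, for some $a\in K$, $\mathcal O_w$ is the smallest among the overrings of $\mathcal O_v$ that contain $a$ and have a $\phi$-compatible unit group. *Principal unfolded differential rank:* for $0\ne g\in G$ let $\psi_g(h)=\psi(h)-\psi(g)$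 $(h\neq0)$, and let $Q_g$ be the set of subgroups $H\neq\{0\}$ of $G$ such that, for some $x\in G$, $H$ is the smallest $\psi_g$-compatible convex subgroup containing $x$. The principal unfolded differential rank is the order type of $\bigcup_{g\neq 0}Q_g$ under inclusion. -/

import Mathlib

namespace DiffRank

noncomputable section

/-! ### Ranks of a set, an ordered group and a valued field with a partial map

A partial map on `A` is given by its domain `dom : Set A` and a function `φ : A → A` whose values
are only used on `dom`. -/

/-- `B` is compatible with the partial map `(dom, φ)`: for all `a ∈ dom`, `a ∈ B ↔ φ a ∈ B`. -/
def IsCompatible {A : Type*} (dom : Set A) (φ : A → A) (B : Set A) : Prop :=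
  ∀ a ∈ dom, (a ∈ B ↔ φ a ∈ B)

section Group

variable {G : Type*} [AddCommGroup G] [LinearOrder G]

/-- The compatible convex subgroups of the ordered group `G` (including possibly the trivial one). -/
def compatibleSubgroups (dom : Set G) (φ : G → G) : Set (AddSubgroup G) :=
  {H | (H : Set G).OrdConnected ∧ IsCompatible dom φ (H : Set G)}

/-- The principal `φ`-rank of the ordered group `G`: the set, ordered by inclusion, of all
non-trivial subgroups `H` which, for some `g`, are the smallest compatible convex subgroup
containing `g`. -/
def groupPrincipalRank (dom : Set G) (φ : G → G) : Set (AddSubgroup G) :=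
  {H | H ≠ ⊥ ∧ ∃ g : G, IsLeast {F | F ∈ compatibleSubgroups dom φ ∧ g ∈ F} H}

/-- `(G, ψ)` is an asymptotic couple. Only the values of `ψ` on nonzero elements matter;
`ψ 0` stands for `∞` in the usual convention. -/
structure IsAsymptoticCouple (ψ : G → G) : Prop where
  ac1 : ∀ g h : G, g ≠ 0 → h ≠ 0 → g + h ≠ 0 → min (ψ g) (ψ h) ≤ ψ (g + h)
  ac2 : ∀ (n : ℤ) (g : G), n ≠ 0 → g ≠ 0 → ψ (n • g) = ψ g
  ac3 : ∀ g h : G, g ≠ 0 → h ≠ 0 → ψ g < ψ h + |h|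

/-- `(G, ψ)` is an asymptotic couple of H-type. -/
structure IsHTypeCouple (ψ : G → G) : Prop extends IsAsymptoticCouple ψ where
  ach : ∀ g h : G, g ≤ h → h < 0 → ψ g ≤ ψ h

/-- `ψ` is of Hardy type: `(G, ψ)` is of H-type and `ψ g = ψ h` forces `g`, `h` to be
archimedean-equivalent, i.e. to have the same natural valuation. -/
structure IsHardyTypeCouple [IsOrderedAddMonoid G] (ψ : G → G) : Prop
    extends IsHTypeCouple ψ where
  hardy : ∀ g h : G, g ≠ 0 → h ≠ 0 → ψ g = ψ h → ArchimedeanClass.mk g = ArchimedeanClass.mk h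

/-- The principal unfolded `ψ`-rank of `(G, ψ)`: the union over `g ≠ 0` of the principal
`ψ_g`-ranks of `G`, where `ψ_g h = ψ h - ψ g` for `h ≠ 0`; it is ordered by inclusion. -/
def groupPrincipalUnfoldedRank (ψ : G → G) : Set (AddSubgroup G) :=
  ⋃ g ∈ {g : G | g ≠ 0}, groupPrincipalRank {h : G | h ≠ 0} (fun h => ψ h - ψ g)

end Group

section Field

variable {K : Type*} [Field K] {G : Type*} [AddCommGroup G] [LinearOrder G] [IsOrderedAddMonoid G]

/-- The valuation ring `{a | 0 ≤ v a}` of a valuation with values in `G ∪ {∞}`. -/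
def valRing (v : AddValuation K (WithTop G)) : ValuationSubring K where
  carrier := {a | 0 ≤ v a}
  mul_mem' {a b} ha hb := by
    simp only [Set.mem_ofPred_eq, AddValuation.map_mul] at *
    exact add_nonneg ha hb
  one_mem' := by simp
  add_mem' {a b} ha hb := (le_min ha hb).trans (v.map_add a b)
  zero_mem' := by simp
  neg_mem' {a} ha := by simpa [AddValuation.map_neg] using ha
  mem_or_inv_mem' a := by
    by_cases h : a = 0
    · left; simp [h]
    · by_contra hc
      simp only [Set.mem_ofPred_eq, not_or, not_le] at hc
      have h1 : v a + v a⁻¹ = 0 := by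
        rw [← AddValuation.map_mul, mul_inv_cancel₀ h, AddValuation.map_one]
      have h2 : v a + v a⁻¹ < 0 :=
        (add_le_add hc.1.le le_rfl).trans_lt (by simpa using hc.2)
      exact absurd h1 h2.ne

/-- The set of units `{a | w(a) = 0}` of (the ring of) a valuation `w`; Mathlib writes the
valuation multiplicatively. -/
def unitSet (w : ValuationSubring K) : Set K := {a | w.valuation a = 1}

/-- The coarsenings `w` of `v` (given by their valuation rings) which are compatible with the
partial map `(dom, φ)` on `K`, i.e. whose set of units is compatible. -/
def compatibleCoarsenings (v : AddValuation K (WithTop G)) (dom : Set K) (φ : K → K) :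
    Set (ValuationSubring K) :=
  {w | valRing v ≤ w ∧ IsCompatible dom φ (unitSet w)}

/-- The principal `φ`-rank of the valued field `(K, v)`: the set, ordered by inclusion, of all
strict coarsenings of `v` which, for some `a`, are the smallest compatible coarsening whose
ring contains `a`. -/
def fieldPrincipalRank (v : AddValuation K (WithTop G)) (dom : Set K) (φ : K → K) :
    Set (ValuationSubring K) :=
  {w | w ≠ valRing v ∧ ∃ a : K, IsLeast {u | u ∈ compatibleCoarsenings v dom φ ∧ a ∈ u} w}

/-- The convex subgroup `G_w = v(units of w)` of the value group attached to a coarsening `w`. -/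
def coarseningGroup (v : AddValuation K (WithTop G)) (w : ValuationSubring K) : Set G :=
  {g | ∃ a ∈ unitSet w, v a = (g : WithTop G)}

/-- `(K, v, D)` is a pre-differential-valued field: if `v a ≥ 0`, `v b > 0` and `b ≠ 0`, then
`v (D a) > v (D b / b)`. -/
def IsPreDifferentialValued (v : AddValuation K (WithTop G)) (D : Derivation ℤ K K) : Prop :=
  ∀ a b : K, 0 ≤ v a → 0 < v b → b ≠ 0 → v (D b / b) < v (D a)

/-- The principal differential rank of `(K, v, D)`: the principal `φ`-rank of `(K, v)`, where `φ`
is the logarithmic derivative on the nonzero elements of nonzero valuation. -/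
def principalDifferentialRank (v : AddValuation K (WithTop G)) (D : Derivation ℤ K K) :
    Set (ValuationSubring K) :=
  fieldPrincipalRank v {a : K | a ≠ 0 ∧ v a ≠ 0} (fun a => D a / a)

/-- The map `ψ` of the asymptotic couple `(G, ψ)` of `(K, v, D)`: for `g ≠ 0`, `ψ g` is the
element `h` of `G` with `v (D a / a) = h` for the elements `a` with `v a = g`.
(In a pre-differential-valued field with value group `G` it exists and does not depend on `a`.) -/
def asymptoticMap (v : AddValuation K (WithTop G)) (D : Derivation ℤ K K) (g : G) : G :=
  Classical.epsilon fun h : G => ∃ a : K, v a = (g : WithTop G) ∧ v (D a / a) = (h : WithTop G)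

/-- The principal unfolded differential rank of `(K, v, D)`: the principal unfolded `ψ`-rank of
its asymptotic couple `(G, ψ)`. -/
def principalUnfoldedDifferentialRank (v : AddValuation K (WithTop G)) (D : Derivation ℤ K K) :
    Set (AddSubgroup G) :=
  groupPrincipalUnfoldedRank (asymptoticMap v D)

variable [LinearOrder K] [IsStrictOrderedRing K]

/-- `(K, v, ≤, D)` is a pre-H-field. -/
structure IsPreHField (v : AddValuation K (WithTop G)) (D : Derivation ℤ K K) : Prop where
  ph1 : IsPreDifferentialValued v D
  ph2 : (valRing v : Set K).OrdConnected
  ph3 : ∀ a : K, (∀ b ∈ valRing v, b < a) → 0 < D a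

/-- `(K, ≤, D)` is an H-field whose valuation is `v`, i.e. the valuation ring of `v` is
`{a | ∃ c, D c = 0 ∧ |a| ≤ c}`, `(K, v, ≤, D)` is a pre-H-field, and every element of the valuation
ring is the sum of a constant and an element of the maximal ideal. -/
structure IsHField (v : AddValuation K (WithTop G)) (D : Derivation ℤ K K) : Prop
    extends IsPreHField v D where
  mem_valRing_iff : ∀ a : K, a ∈ valRing v ↔ ∃ c : K, D c = 0 ∧ |a| ≤ c
  h2 : ∀ a ∈ valRing v, ∃ c m : K, D c = 0 ∧ 0 < v m ∧ a = c + m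

/-- `D` is a derivation of Hardy type on the ordered field `K`: `(K, ≤, D)` is an H-field (with
valuation `v`) whose asymptotic couple is of Hardy type. -/
structure IsHardyTypeDerivation (v : AddValuation K (WithTop G)) (D : Derivation ℤ K K) : Prop
    extends IsHField v D where
  hardyType : IsHardyTypeCouple (asymptoticMap v D)

end Field

/-! ### The ordered valued field `k((G))` -/

section PowerSeries

variable (k : Type*) [Field k] [LinearOrder k] [IsStrictOrderedRing k]
variable (G : Type*) [AddCommGroup G] [LinearOrder G] [IsOrderedAddMonoid G]

/-- The field `k((G))` of generalized power series; `Lex` carries Mathlib's order on it, in which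
`a < b` if and only if `a_g < b_g` at the least `g` with `a_g ≠ b_g`. -/
abbrev PowerSeriesField : Type _ := Lex (HahnSeries G k)

instance : IsStrictOrderedRing (PowerSeriesField k G) :=
  IsStrictOrderedRing.of_mul_pos fun a b ha hb => by
    rw [← HahnSeries.leadingCoeff_pos_iff] at *
    have : ofLex (a * b) = ofLex a * ofLex b := rfl
    rw [this, HahnSeries.leadingCoeff_mul]
    exact mul_pos ha hb

/-- The valuation `v a = min (supp a)` (and `v 0 = ∞`) of `k((G))`. -/
def powerSeriesVal : AddValuation (PowerSeriesField k G) (WithTop G) :=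
  AddValuation.of (fun a => (ofLex a).orderTop)
    (HahnSeries.addVal G k).map_zero (HahnSeries.addVal G k).map_one
    (fun a b => (HahnSeries.addVal G k).map_add (ofLex a) (ofLex b))
    (fun a b => (HahnSeries.addVal G k).map_mul (ofLex a) (ofLex b))

end PowerSeries

end

end DiffRank

universe u

/-! Let `I` be the lexicographic product of the reversed order `Q` with `ℤ`, let `τ` be the
successor on each copy of `ℤ`, and let `G` be the real Hahn group over `I`, with `e_i = basis i`. A
nonzero `g` with least index `i` has a "logarithm" `e_(τ i)`: positive, below `|g|`, and determining
the archimedean class of `g`. For any `s` in `G`, the rule `t^g ↦ -t^(g+s) ∑ g_i t^(-e_(τ i))`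
extends by strong additivity to a derivation with `ψ g = s - log g`, which is of Hardy type. The
substance here is summability (`not_antitone_sub_basis`) and control of the leading term
(`sub_basis_lt_sub_basis`).

A nontrivial convex subgroup is `ψ`-compatible iff it contains `s` and is closed under taking and
undoing logarithms. Undoing logarithms runs down a copy of `ℤ` without end, so such a subgroup
contains `cut q` as soon as it has an element with leading index in the copy of `q`
(`cut_le_of_mem`). Hence the principal `ψ`-rank is the set of those `cut q` that contain `s`.
Passing to `ψ_g` replaces `s` by `log g`, so the unfolded rank is the set of all cuts, whatever `s`
is. The choice of `s` then prescribes `P`. The correspondence between coarsenings of `v` and convex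
subgroups of `G` carries this over to the field. -/

namespace DiffRank

noncomputable section

open HahnSeries

/-! ### The Hahn group with real coefficients -/

section HahnGroup

variable {I : Type*} [LinearOrder I]

/-- The lexicographically ordered Hahn group over `I` with real coefficients. -/
abbrev HahnGroup (I : Type*) [LinearOrder I] : Type _ := Lex (HahnSeries I ℝ)

namespace HahnGroup

/-- The element of the Hahn group with coefficient `1` at `i` and `0` elsewhere. -/
def basis (i : I) : HahnGroup I := toLex (single i 1)

/-- The coefficient at `i`, as a homomorphism. -/
def coeffHom (i : I) : HahnGroup I →+ ℝ where
  toFun g := (ofLex g).coeff i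
  map_zero' := rfl
  map_add' _ _ := rfl

theorem orderTop_basis (i : I) : (ofLex (basis i)).orderTop = i :=
  orderTop_single one_ne_zero

theorem basis_pos (i : I) : 0 < basis i := by
  rw [← leadingCoeff_pos_iff]
  simp [basis]

theorem orderTop_le_of_abs_le {x y : HahnGroup I} (h : |x| ≤ |y|) :
    (ofLex y).orderTop ≤ (ofLex x).orderTop := by
  by_contra! hc
  exact (abs_lt_abs_of_orderTop_ofLex hc).not_ge h

theorem basis_lt_abs {x : HahnGroup I} {i : I} (h : (ofLex x).orderTop < i) :
    basis i < |x| := by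
  have := abs_lt_abs_of_orderTop_ofLex (x := basis i) (y := x) (by rwa [orderTop_basis])
  rwa [abs_of_pos (basis_pos i)] at this

theorem basis_strictAnti : StrictAnti (basis : I → HahnGroup I) := fun i j h => by
  have := basis_lt_abs (x := basis i) (i := j) (by rw [orderTop_basis]; exact_mod_cast h)
  rwa [abs_of_pos (basis_pos i)] at this

theorem exists_orderTop_eq {x : HahnGroup I} (hx : x ≠ 0) : ∃ i : I, (ofLex x).orderTop = i := by
  have : (ofLex x).orderTop ≠ ⊤ := orderTop_ne_top.2 hx
  exact ⟨_, (WithTop.coe_untop _ this).symm⟩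

theorem ne_zero_of_orderTop {x : HahnGroup I} {i : I} (h : (ofLex x).orderTop = i) : x ≠ 0 := by
  rintro rfl
  simp at h

theorem coeff_eq_zero_of_abs_le {x y : HahnGroup I} {i : I} (h : |x| ≤ |y|)
    (hy : (i : WithTop I) < (ofLex y).orderTop) : (ofLex x).coeff i = 0 :=
  coeff_eq_zero_of_lt_orderTop (hy.trans_le (orderTop_le_of_abs_le h))

theorem coeff_neg_of_orderTop {x : HahnGroup I} {i : I} (h : (ofLex x).orderTop = i) (hx : x < 0) :
    (ofLex x).coeff i < 0 := by
  have hne : ofLex x ≠ 0 := hx.ne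
  rw [← leadingCoeff_neg_iff, leadingCoeff_of_ne_zero hne] at hx
  simpa [h] using hx

variable (τ : I → I)

open Classical in
/-- The basis element whose index is the image under `τ` of the least index of the support. -/
def logElt (g : HahnGroup I) : HahnGroup I :=
  if h : (ofLex g).orderTop ≠ ⊤ then basis (τ ((ofLex g).orderTop.untop h)) else 0

theorem logElt_eq {g : HahnGroup I} {i : I} (h : (ofLex g).orderTop = i) :
    logElt τ g = basis (τ i) := by
  simp [logElt, h]

theorem logElt_pos {g : HahnGroup I} (hg : g ≠ 0) : 0 < logElt τ g := by
  obtain ⟨i, hi⟩ := exists_orderTop_eq hg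
  rw [logElt_eq τ hi]
  exact basis_pos _

variable {τ}

theorem logElt_lt_abs (hlt : ∀ i, i < τ i) {g : HahnGroup I} (hg : g ≠ 0) : logElt τ g < |g| := by
  obtain ⟨i, hi⟩ := exists_orderTop_eq hg
  rw [logElt_eq τ hi]
  exact basis_lt_abs (by rw [hi]; exact_mod_cast hlt i)

theorem logElt_le_logElt (hτ : StrictMono τ) {g h : HahnGroup I} (hg : g ≠ 0) (hh : h ≠ 0) :
    logElt τ g ≤ logElt τ h ↔ (ofLex h).orderTop ≤ (ofLex g).orderTop := by
  obtain ⟨i, hi⟩ := exists_orderTop_eq hg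
  obtain ⟨j, hj⟩ := exists_orderTop_eq hh
  rw [logElt_eq τ hi, logElt_eq τ hj, basis_strictAnti.le_iff_ge, hτ.le_iff_le, hi, hj,
    WithTop.coe_le_coe]

theorem logElt_add_le (hτ : StrictMono τ) {g h : HahnGroup I} (hg : g ≠ 0) (hh : h ≠ 0)
    (hgh : g + h ≠ 0) : logElt τ (g + h) ≤ max (logElt τ g) (logElt τ h) := by
  have := min_orderTop_le_orderTop_add (x := ofLex g) (y := ofLex h)
  rw [le_max_iff, logElt_le_logElt hτ hgh hg, logElt_le_logElt hτ hgh hh]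
  exact min_le_iff.1 this

/-- Since `τ` is strictly monotone, comparing logarithms amounts to comparing least indices in
reverse; `i < τ i` puts the logarithm below `|h|`, which gives `ac3`. Equal logarithms force equal
least indices, and archimedeanness of `ℝ` does the rest. -/
theorem isHardyTypeCouple_of_logElt (hτ : StrictMono τ) (hlt : ∀ i, i < τ i) (s : HahnGroup I)
    {ψ : HahnGroup I → HahnGroup I} (hψ : ∀ g, g ≠ 0 → ψ g = s - logElt τ g) :
    IsHardyTypeCouple ψ where
  ac1 g h hg hh hgh := by
    rw [hψ g hg, hψ h hh, hψ _ hgh, min_sub_sub_left]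
    exact sub_le_sub_left (logElt_add_le hτ hg hh hgh) s
  ac2 n g hn hg := by
    have hng : n • g ≠ 0 := smul_ne_zero hn hg
    obtain ⟨i, hi⟩ := exists_orderTop_eq hg
    have hc (j : I) : (ofLex (n • g)).coeff j = n * (ofLex g).coeff j :=
      (map_zsmul (coeffHom j) n g).trans (zsmul_eq_mul _ _)
    have hi' : (ofLex (n • g)).orderTop = i := by
      refine orderTop_eq_of_le ?_ fun j hj => ?_
      · simpa [hc, hn] using coeff_orderTop_ne hi
      · have hj' : (ofLex g).coeff j ≠ 0 := fun h => hj (by simp [hc, h])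
        exact_mod_cast hi ▸ orderTop_le_of_coeff_ne_zero hj'
    rw [hψ _ hng, hψ g hg, logElt_eq τ hi, logElt_eq τ hi']
  ac3 g h hg hh := by
    rw [hψ g hg, hψ h hh]
    have h1 := logElt_pos τ hg
    have h2 := logElt_lt_abs hlt hh
    calc s - logElt τ g < s := sub_lt_self s h1
      _ < s - logElt τ h + |h| := by
        rw [sub_add_eq_add_sub, lt_sub_iff_add_lt]
        gcongr
  ach g h hgh hh := by
    rw [hψ g (hgh.trans_lt hh).ne, hψ h hh.ne, sub_le_sub_iff_left,
      logElt_le_logElt hτ hh.ne (hgh.trans_lt hh).ne]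
    apply orderTop_le_of_abs_le
    rw [abs_of_neg hh, abs_of_neg (hgh.trans_lt hh)]
    exact neg_le_neg hgh
  hardy g h hg hh e := by
    rw [hψ g hg, hψ h hh, sub_right_inj] at e
    rw [archimedeanClassMk_eq_archimedeanClassMk_iff]
    refine ⟨le_antisymm ((logElt_le_logElt hτ hh hg).1 e.ge) ((logElt_le_logElt hτ hg hh).1 e.le), ?_⟩
    exact ArchimedeanClass.mk_eq_mk_of_archimedean
      (leadingCoeff_ne_zero.2 (show ofLex g ≠ 0 from hg))
      (leadingCoeff_ne_zero.2 (show ofLex h ≠ 0 from hh))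

end HahnGroup
end HahnGroup

/-! ### The strongly additive derivation on power series over a Hahn group -/

section HahnDerivation

open HahnGroup

variable {I : Type*} [LinearOrder I] {τ : I → I}

/-- This is the source of summability. Pass to a subsequence with `g` increasing and the indices
either weakly increasing or strictly decreasing. In the first case two terms coincide, against
injectivity. In the second, `g n - g 0` is too small to have a coefficient at `i n`, so every `i n`
lies in the well-ordered support of the first `g`. -/
theorem not_antitone_sub_basis (hτ : StrictMono τ) (hlt : ∀ i, i < τ i) {S : Set (HahnGroup I)}
    (hS : S.IsPWO) {g : ℕ → HahnGroup I} {i : ℕ → I} (hg : ∀ n, g n ∈ S)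
    (hi : ∀ n, (ofLex (g n)).coeff (i n) ≠ 0) (hinj : Function.Injective fun n => (g n, i n)) :
    ¬ Antitone fun n => g n - basis (τ (i n)) := by
  intro hanti
  obtain ⟨φ, hφ⟩ := hS.exists_monotone_subseq hg
  obtain ⟨χ, hχ | hχ⟩ := exists_increasing_or_nonincreasing_subseq (· ≤ ·) (i ∘ φ)
  · have h01 : χ 0 < χ 1 := χ.lt_iff_lt.2 zero_lt_one
    have h1 : g (φ (χ 0)) ≤ g (φ (χ 1)) := hφ h01.le
    have h2 : i (φ (χ 0)) ≤ i (φ (χ 1)) := hχ 0 1 zero_lt_one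
    have h3 := hanti (φ.monotone h01.le)
    have h4 : basis (τ (i (φ (χ 1)))) ≤ basis (τ (i (φ (χ 0)))) :=
      basis_strictAnti.antitone (hτ.monotone h2)
    dsimp only at h3
    have h5 : g (φ (χ 1)) = g (φ (χ 0)) :=
      le_antisymm (by simpa using add_le_add h3 h4) h1
    rw [h5, sub_le_sub_iff_left] at h3
    have h6 := (hτ.le_iff_le.1 (basis_strictAnti.le_iff_ge.1 h3)).antisymm h2
    have := hinj (Prod.ext h5 h6 : (g _, i _) = (g _, i _))
    exact h01.ne' (φ.injective this)
  · have hanti' : StrictAnti fun n => i (φ (χ (n + 1))) := fun m n hmn =>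
      not_le.1 (hχ (m + 1) (n + 1) (by omega))
    refine Set.isWF_iff_no_descending_seq.1 (ofLex (g (φ (χ 0)))).isWF_support _ hanti' fun n => ?_
    have h0n : φ (χ 0) ≤ φ (χ (n + 1)) := φ.monotone (χ.monotone (Nat.zero_le _))
    have h1 : g (φ (χ 0)) ≤ g (φ (χ (n + 1))) := hφ (χ.monotone (Nat.zero_le _))
    have h2 := hanti h0n
    set x := g (φ (χ (n + 1))) - g (φ (χ 0)) with hx
    set b := basis (τ (i (φ (χ (n + 1))))) with hb
    have h3 : x ≤ b := by
      have : x ≤ b - basis (τ (i (φ (χ 0)))) := by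
        rw [hx, sub_le_iff_le_add, sub_add_eq_add_sub, add_sub_assoc]
        simpa using sub_le_iff_le_add'.1 h2
      exact this.trans (sub_le_self _ (basis_pos _).le)
    have h4 : (ofLex x).coeff (i (φ (χ (n + 1)))) = 0 := by
      refine coeff_eq_zero_of_abs_le (y := b) ?_ ?_
      · rwa [abs_of_nonneg (sub_nonneg.2 h1), abs_of_pos (basis_pos _)]
      · rw [hb, orderTop_basis]
        exact_mod_cast hlt _
    have h5 : (ofLex (g (φ (χ (n + 1))))).coeff (i (φ (χ (n + 1))))
        - (ofLex (g (φ (χ 0)))).coeff (i (φ (χ (n + 1)))) = 0 := h4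
    rw [HahnSeries.mem_support, ← sub_eq_zero.1 h5]
    exact hi _

/-- Among the exponents produced by differentiating a series of value `g`, the least comes only from
the pair `(g, i₀)`. An index `i < i₀` could subtract more, but then `g' - g` has a nonzero
coefficient at `i` and outweighs `basis (τ i)`. -/
theorem sub_basis_lt_sub_basis (hτ : StrictMono τ) (hlt : ∀ i, i < τ i) {g g' : HahnGroup I}
    {i₀ i : I} (hg : (ofLex g).orderTop = i₀) (hle : g ≤ g') (hi : (ofLex g').coeff i ≠ 0)
    (hne : g' = g → i ≠ i₀) : g - basis (τ i₀) < g' - basis (τ i) := by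
  obtain h | h := le_or_gt i₀ i
  · have hb : basis (τ i) ≤ basis (τ i₀) := basis_strictAnti.antitone (hτ.monotone h)
    obtain rfl | hlt' := hle.eq_or_lt
    · have : i₀ < i := h.lt_of_ne (hne rfl).symm
      exact sub_lt_sub_left (basis_strictAnti (hτ this)) _
    · exact (sub_lt_sub_right hlt' _).trans_le (sub_le_sub_left hb _)
  · have h0 : (ofLex g).coeff i = 0 := coeff_eq_zero_of_lt_orderTop (by rw [hg]; exact_mod_cast h)
    have h1 : (ofLex (g' - g)).coeff i ≠ 0 := by
      have : (ofLex (g' - g)).coeff i = (ofLex g').coeff i - (ofLex g).coeff i := rfl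
      rwa [this, h0, sub_zero]
    have h2 : basis (τ i) < |g' - g| :=
      basis_lt_abs ((orderTop_le_of_coeff_ne_zero h1).trans_lt (by exact_mod_cast hlt i))
    rw [abs_of_nonneg (sub_nonneg.2 hle)] at h2
    calc g - basis (τ i₀) < g := sub_lt_self _ (basis_pos _)
      _ < g' - basis (τ i) := lt_sub_comm.1 h2

/-- The derivation `∑ a_g t^g ↦ ∑ g_i a_g t^g`. -/
def partialDeriv (i : I) (a : HahnSeries (HahnGroup I) ℝ) : HahnSeries (HahnGroup I) ℝ where
  coeff g := (ofLex g).coeff i * a.coeff g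
  isPWO_support' := a.isPWO_support.mono fun _ hg => right_ne_zero_of_mul hg

theorem partialDeriv_mul (i : I) (a b : HahnSeries (HahnGroup I) ℝ) :
    partialDeriv i (a * b) = a * partialDeriv i b + b * partialDeriv i a := by
  have hsub (c : HahnSeries (HahnGroup I) ℝ) : (partialDeriv i c).support ⊆ c.support :=
    fun g hg => right_ne_zero_of_mul hg
  ext g
  -- Summing over the full supports of `a` and `b` gives all three products the same index set.
  rw [coeff_add, mul_comm b, coeff_mul_right' b.isPWO_support (hsub b),
    coeff_mul_left' a.isPWO_support (hsub a), ← Finset.sum_add_distrib]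
  change _ * (a * b).coeff g = _
  rw [coeff_mul, Finset.mul_sum]
  refine Finset.sum_congr rfl fun x hx => ?_
  have hx' : x.1 + x.2 = g := (Finset.mem_antidiagonal.1 hx).2.2
  have : (ofLex g).coeff i = (ofLex x.1).coeff i + (ofLex x.2).coeff i := by
    rw [← hx']; rfl
  change _ = a.coeff x.1 * (_ * b.coeff x.2) + _ * a.coeff x.1 * b.coeff x.2
  rw [this]
  ring

variable (τ) in
/-- The `i`-th summand of the derivation. -/
def logDerivTerm (a : HahnSeries (HahnGroup I) ℝ) (i : I) : HahnSeries (HahnGroup I) ℝ :=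
  single (-basis (τ i)) 1 * partialDeriv i a

theorem coeff_logDerivTerm (a : HahnSeries (HahnGroup I) ℝ) (i : I) (h : HahnGroup I) :
    (logDerivTerm τ a i).coeff h =
      (ofLex (h + basis (τ i))).coeff i * a.coeff (h + basis (τ i)) := by
  rw [logDerivTerm, coeff_single_mul, one_mul, sub_neg_eq_add]
  rfl

/-- The summands of the derivation, as a summable family. -/
def logDerivFamily (hτ : StrictMono τ) (hlt : ∀ i, i < τ i) (a : HahnSeries (HahnGroup I) ℝ) :
    SummableFamily (HahnGroup I) ℝ I where
  toFun := logDerivTerm τ a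
  isPWO_iUnion_support' := by
    rw [Set.isPWO_iff_isWF, Set.isWF_iff_no_descending_seq]
    intro f hf hmem
    simp only [Set.mem_iUnion, HahnSeries.mem_support, coeff_logDerivTerm] at hmem
    choose i hi using hmem
    have hfi (n : ℕ) : f n + basis (τ (i n)) - basis (τ (i n)) = f n := add_sub_cancel_right _ _
    refine not_antitone_sub_basis hτ hlt (g := fun n => f n + basis (τ (i n))) (i := i)
      a.isPWO_support (fun n => right_ne_zero_of_mul (hi n)) (fun n => left_ne_zero_of_mul (hi n))
      (fun m n hmn => ?_) ?_
    · simp only [Prod.mk.injEq] at hmn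
      rw [hmn.2, add_left_inj] at hmn
      exact hf.injective hmn.1
    · simpa only [hfi] using hf.antitone
  finite_co_support' h := by
    -- Infinitely many terms at one exponent `h` would give a constant, hence antitone, sequence.
    by_contra hinf
    have : Infinite {i | (logDerivTerm τ a i).coeff h ≠ 0} := Set.infinite_coe_iff.2 hinf
    let f := Infinite.natEmbedding {i | (logDerivTerm τ a i).coeff h ≠ 0}
    have hf (n : ℕ) := (f n).2
    simp only [Set.mem_ofPred_eq, coeff_logDerivTerm] at hf
    refine not_antitone_sub_basis hτ hlt (g := fun n => h + basis (τ (f n))) (i := fun n => f n)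
      a.isPWO_support (fun n => right_ne_zero_of_mul (hf n)) (fun n => left_ne_zero_of_mul (hf n))
      (fun m n hmn => ?_) ?_
    · exact f.injective (Subtype.ext (Prod.mk.inj hmn).2)
    · simp only [add_sub_cancel_right]
      exact antitone_const

theorem logDerivFamily_apply (hτ : StrictMono τ) (hlt : ∀ i, i < τ i)
    (a : HahnSeries (HahnGroup I) ℝ) (i : I) :
    logDerivFamily hτ hlt a i = logDerivTerm τ a i := rfl

theorem coeff_hsum_logDerivFamily (hτ : StrictMono τ) (hlt : ∀ i, i < τ i)
    (a : HahnSeries (HahnGroup I) ℝ) (h : HahnGroup I) :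
    (logDerivFamily hτ hlt a).hsum.coeff h =
      ∑ᶠ i, (ofLex (h + basis (τ i))).coeff i * a.coeff (h + basis (τ i)) := by
  rw [SummableFamily.coeff_hsum]
  exact finsum_congr fun i => coeff_logDerivTerm a i h

theorem logDerivFamily_add (hτ : StrictMono τ) (hlt : ∀ i, i < τ i)
    (a b : HahnSeries (HahnGroup I) ℝ) : logDerivFamily hτ hlt (a + b) =
      logDerivFamily hτ hlt a + logDerivFamily hτ hlt b := by
  refine SummableFamily.ext fun i => ?_
  ext h
  simp only [SummableFamily.add_apply, coeff_add, logDerivFamily_apply, coeff_logDerivTerm, mul_add]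

theorem logDerivFamily_mul (hτ : StrictMono τ) (hlt : ∀ i, i < τ i)
    (a b : HahnSeries (HahnGroup I) ℝ) : logDerivFamily hτ hlt (a * b) =
      a • logDerivFamily hτ hlt b + b • logDerivFamily hτ hlt a := by
  refine SummableFamily.ext fun i => ?_
  simp only [SummableFamily.add_apply, SummableFamily.smul_apply, logDerivFamily_apply,
    logDerivTerm, partialDeriv_mul, HahnSeries.of_symm_smul_of_eq_mul]
  ring

/-- The derivation `t^g ↦ t^g ∑ g_i t^(-basis (τ i))`, extended to series by strong additivity. -/
def hahnDerivation (hτ : StrictMono τ) (hlt : ∀ i, i < τ i) :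
    Derivation ℤ (PowerSeriesField ℝ (HahnGroup I)) (PowerSeriesField ℝ (HahnGroup I)) :=
  Derivation.mk'
    (AddMonoidHom.toIntLinearMap (AddMonoidHom.mk'
      (fun a : PowerSeriesField ℝ (HahnGroup I) =>
        (toLex (logDerivFamily hτ hlt (ofLex a)).hsum : PowerSeriesField ℝ (HahnGroup I)))
      fun a b => by
        change toLex (logDerivFamily hτ hlt (ofLex a + ofLex b)).hsum = _
        rw [logDerivFamily_add, SummableFamily.hsum_add]
        rfl))
    fun a b => by
      change toLex (logDerivFamily hτ hlt (ofLex a * ofLex b)).hsum = _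
      rw [logDerivFamily_mul, SummableFamily.hsum_add, SummableFamily.hsum_smul,
        SummableFamily.hsum_smul]
      rfl

theorem coeff_hahnDerivation (hτ : StrictMono τ) (hlt : ∀ i, i < τ i)
    (a : PowerSeriesField ℝ (HahnGroup I)) (h : HahnGroup I) :
    (ofLex (hahnDerivation hτ hlt a)).coeff h =
      ∑ᶠ i, (ofLex (h + basis (τ i))).coeff i * (ofLex a).coeff (h + basis (τ i)) :=
  coeff_hsum_logDerivFamily hτ hlt (ofLex a) h

theorem coeff_hahnDerivation_leading (hτ : StrictMono τ) (hlt : ∀ i, i < τ i)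
    {a : PowerSeriesField ℝ (HahnGroup I)} {g : HahnGroup I} {i : I}
    (ha : (ofLex a).orderTop = g) (hg : (ofLex g).orderTop = i) :
    (ofLex (hahnDerivation hτ hlt a)).coeff (g - basis (τ i)) =
      (ofLex g).coeff i * (ofLex a).coeff g := by
  rw [coeff_hahnDerivation, finsum_eq_single _ i, sub_add_cancel]
  intro j hj
  by_contra h
  refine (sub_basis_lt_sub_basis hτ hlt (g' := g - basis (τ i) + basis (τ j)) (i := j) hg ?_
    (left_ne_zero_of_mul h) fun _ => hj).ne (add_sub_cancel_right _ _).symm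
  rw [← WithTop.coe_le_coe, ← ha]
  exact orderTop_le_of_coeff_ne_zero (right_ne_zero_of_mul h)

theorem orderTop_hahnDerivation (hτ : StrictMono τ) (hlt : ∀ i, i < τ i)
    {a : PowerSeriesField ℝ (HahnGroup I)} {g : HahnGroup I}
    (ha : (ofLex a).orderTop = g) (hg : g ≠ 0) :
    (ofLex (hahnDerivation hτ hlt a)).orderTop = (g - logElt τ g : HahnGroup I) := by
  obtain ⟨i, hi⟩ := exists_orderTop_eq hg
  rw [logElt_eq τ hi]
  refine orderTop_eq_of_le ?_ fun h hh => ?_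
  · rw [HahnSeries.mem_support, coeff_hahnDerivation_leading hτ hlt ha hi]
    exact mul_ne_zero (coeff_orderTop_ne hi) (coeff_orderTop_ne ha)
  · rw [HahnSeries.mem_support, coeff_hahnDerivation] at hh
    obtain ⟨j, hj⟩ : ∃ j, (ofLex (h + basis (τ j))).coeff j *
        (ofLex a).coeff (h + basis (τ j)) ≠ 0 := by
      by_contra! hc
      exact hh (finsum_eq_zero_of_forall_eq_zero hc)
    have hle : g ≤ h + basis (τ j) := by
      rw [← WithTop.coe_le_coe, ← ha]
      exact orderTop_le_of_coeff_ne_zero (right_ne_zero_of_mul hj)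
    by_cases hc : h + basis (τ j) = g ∧ j = i
    · obtain ⟨h1, rfl⟩ := hc
      exact (sub_eq_of_eq_add h1.symm).le
    · have := sub_basis_lt_sub_basis hτ hlt hi hle (left_ne_zero_of_mul hj)
        fun h1 h2 => hc ⟨h1, h2⟩
      rw [add_sub_cancel_right] at this
      exact this.le

/-- A negative `g` has negative leading coefficient, and this is the factor acquired by the leading
term. The sign in `shiftedDerivation` corrects it. -/
theorem hahnDerivation_neg (hτ : StrictMono τ) (hlt : ∀ i, i < τ i)
    {a : PowerSeriesField ℝ (HahnGroup I)} {g : HahnGroup I}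
    (ha : (ofLex a).orderTop = g) (hg : g < 0) (ha0 : 0 < a) : hahnDerivation hτ hlt a < 0 := by
  obtain ⟨i, hi⟩ := exists_orderTop_eq hg.ne
  have h1 := orderTop_hahnDerivation hτ hlt ha hg.ne
  rw [logElt_eq τ hi] at h1
  have hne : ofLex (hahnDerivation hτ hlt a) ≠ 0 := by
    rw [← orderTop_ne_top, h1]; exact WithTop.coe_ne_top
  have hne' : ofLex a ≠ 0 := by
    rw [← orderTop_ne_top, ha]; exact WithTop.coe_ne_top
  rw [← leadingCoeff_pos_iff, leadingCoeff_of_ne_zero hne'] at ha0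
  simp only [ha, WithTop.untop_coe] at ha0
  rw [← leadingCoeff_neg_iff, leadingCoeff_of_ne_zero hne]
  simp only [h1, WithTop.untop_coe]
  rw [coeff_hahnDerivation_leading hτ hlt ha hi]
  exact mul_neg_of_neg_of_pos (coeff_neg_of_orderTop hi hg) ha0

theorem hahnDerivation_const (hτ : StrictMono τ) (hlt : ∀ i, i < τ i) (r : ℝ) :
    hahnDerivation hτ hlt (toLex (HahnSeries.C r)) = 0 := by
  apply ofLex.injective
  ext h
  rw [coeff_hahnDerivation]
  refine finsum_eq_zero_of_forall_eq_zero fun i => ?_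
  by_cases h0 : h + basis (τ i) = 0
  · simp [h0]
  · simp [h0]

end HahnDerivation

/-! ### ### Scaling to a derivation of Hardy type -/

section HardyDerivation

open HahnGroup

variable {I : Type*} [LinearOrder I] {τ : I → I}

theorem val_le_of_abs_le {G : Type*} [AddCommGroup G] [LinearOrder G] [IsOrderedAddMonoid G]
    {a b : PowerSeriesField ℝ G} (h : |a| ≤ |b|) :
    powerSeriesVal ℝ G b ≤ powerSeriesVal ℝ G a := by
  by_contra! hc
  exact (abs_lt_abs_of_orderTop_ofLex hc).not_ge h

theorem val_single {G : Type*} [AddCommGroup G] [LinearOrder G] [IsOrderedAddMonoid G]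
    (g : G) {r : ℝ} (hr : r ≠ 0) :
    powerSeriesVal ℝ G (toLex (single g r)) = g :=
  orderTop_single hr

theorem exists_val_eq {G : Type*} [AddCommGroup G] [LinearOrder G] [IsOrderedAddMonoid G]
    {a : PowerSeriesField ℝ G} (ha : a ≠ 0) : ∃ g : G, powerSeriesVal ℝ G a = g :=
  WithTop.ne_top_iff_exists.1 (orderTop_ne_top.2 (show ofLex a ≠ 0 from ha)) |>.imp
    fun _ h => h.symm

theorem zero_lt_val_sub_const {G : Type*} [AddCommGroup G] [LinearOrder G] [IsOrderedAddMonoid G]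
    {a : PowerSeriesField ℝ G} (ha : 0 ≤ powerSeriesVal ℝ G a) :
    0 < powerSeriesVal ℝ G (a - toLex (HahnSeries.C ((ofLex a).coeff 0))) := by
  set m := a - toLex (HahnSeries.C ((ofLex a).coeff 0)) with hm
  have hc (j : G) : (ofLex m).coeff j =
    (ofLex a).coeff j - (HahnSeries.C ((ofLex a).coeff 0) : HahnSeries G ℝ).coeff j := rfl
  by_contra! hle
  have hm0 : m ≠ 0 := by
    intro h
    rw [h, AddValuation.map_zero] at hle
    exact absurd hle (by simp)
  obtain ⟨g, hg⟩ := exists_val_eq hm0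
  have h1 : (ofLex m).coeff g ≠ 0 := coeff_orderTop_ne hg
  rw [hg] at hle
  have hle' : g ≤ 0 := by exact_mod_cast hle
  rw [hc] at h1
  obtain rfl | hlt := hle'.eq_or_lt
  · simp at h1
  · have h2 : (ofLex a).coeff g = 0 :=
      coeff_eq_zero_of_lt_orderTop (lt_of_lt_of_le (by exact_mod_cast hlt) ha)
    simp [h2, hlt.ne] at h1

theorem exists_abs_le_const {G : Type*} [AddCommGroup G] [LinearOrder G] [IsOrderedAddMonoid G]
    {a : PowerSeriesField ℝ G} (ha : 0 ≤ powerSeriesVal ℝ G a) :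
    |a| ≤ toLex (HahnSeries.C (|(ofLex a).coeff 0| + 1)) := by
  have key (x : PowerSeriesField ℝ G) (hx : 0 ≤ powerSeriesVal ℝ G x) (r : ℝ)
      (hr : (ofLex x).coeff 0 < r) : x ≤ toLex (HahnSeries.C r) := by
    -- The strict inequality at exponent `0` decides the order; the `+ 1` in the bound secures
    -- strictness.
    refine ((lt_iff _ _).2 ⟨0, fun j hj => ?_, by simpa using hr⟩).le
    rw [coeff_eq_zero_of_lt_orderTop (lt_of_lt_of_le (by exact_mod_cast hj) hx)]
    simp [hj.ne]
  rw [abs_le']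
  refine ⟨key _ ha _ ?_, key _ (by rwa [AddValuation.map_neg]) _ ?_⟩
  · linarith [le_abs_self ((ofLex a).coeff 0)]
  · change -(ofLex a).coeff 0 < _
    linarith [neg_le_abs ((ofLex a).coeff 0)]

/-- The multiple `c D` of a derivation `D`. -/
def scaledDerivation {R : Type*} [CommRing R] (c : R) (D : Derivation ℤ R R) : Derivation ℤ R R :=
  c • D

/-- The derivation `t^g ↦ -t^(g + s) ∑ g_i t^(-basis (τ i))`. -/
def shiftedDerivation (hτ : StrictMono τ) (hlt : ∀ i, i < τ i) (s : HahnGroup I) :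
    Derivation ℤ (PowerSeriesField ℝ (HahnGroup I)) (PowerSeriesField ℝ (HahnGroup I)) :=
  scaledDerivation (toLex (single s (-1)) : PowerSeriesField ℝ (HahnGroup I))
    (hahnDerivation hτ hlt)

section

variable (hτ : StrictMono τ) (hlt : ∀ i, i < τ i) (s : HahnGroup I)

theorem shiftedDerivation_apply (a : PowerSeriesField ℝ (HahnGroup I)) :
    shiftedDerivation hτ hlt s a = toLex (single s (-1)) * hahnDerivation hτ hlt a := rfl

theorem val_shiftedDerivation {a : PowerSeriesField ℝ (HahnGroup I)} {g : HahnGroup I}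
    (ha : powerSeriesVal ℝ _ a = g) (hg : g ≠ 0) :
    powerSeriesVal ℝ _ (shiftedDerivation hτ hlt s a) = (s - logElt τ g + g : HahnGroup I) := by
  have h := orderTop_hahnDerivation hτ hlt ha hg
  change powerSeriesVal ℝ _ (hahnDerivation hτ hlt a) = _ at h
  rw [shiftedDerivation_apply, AddValuation.map_mul, val_single s (by norm_num), h, ← WithTop.coe_add,
    sub_add_eq_add_sub, add_sub_assoc]

theorem val_logDeriv_shiftedDerivation {a : PowerSeriesField ℝ (HahnGroup I)} {g : HahnGroup I}
    (ha : powerSeriesVal ℝ _ a = g) (hg : g ≠ 0) :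
    powerSeriesVal ℝ _ (shiftedDerivation hτ hlt s a / a) = (s - logElt τ g : HahnGroup I) := by
  rw [AddValuation.map_div, val_shiftedDerivation hτ hlt s ha hg, ha,
    ← WithTop.LinearOrderedAddCommGroup.coe_sub, add_sub_cancel_right]

theorem shiftedDerivation_const (r : ℝ) :
    shiftedDerivation hτ hlt s (toLex (HahnSeries.C r)) = 0 := by
  rw [shiftedDerivation_apply, hahnDerivation_const, mul_zero]

theorem val_nonneg_of_shiftedDerivation_eq_zero {a : PowerSeriesField ℝ (HahnGroup I)}
    (ha : shiftedDerivation hτ hlt s a = 0) : 0 ≤ powerSeriesVal ℝ _ a := by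
  obtain rfl | h0 := eq_or_ne a 0
  · simp
  obtain ⟨g, hg⟩ := exists_val_eq h0
  obtain rfl | hg0 := eq_or_ne g 0
  · exact hg.ge
  have := val_shiftedDerivation hτ hlt s hg hg0
  rw [ha, AddValuation.map_zero] at this
  exact absurd this.symm (WithTop.coe_ne_top)

theorem mem_valRing_iff_exists_const {a : PowerSeriesField ℝ (HahnGroup I)} :
    a ∈ valRing (powerSeriesVal ℝ (HahnGroup I)) ↔
      ∃ c, shiftedDerivation hτ hlt s c = 0 ∧ |a| ≤ c :=
  ⟨fun ha => ⟨_, shiftedDerivation_const hτ hlt s _, exists_abs_le_const ha⟩,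
    fun ⟨c, hc, hac⟩ => (val_nonneg_of_shiftedDerivation_eq_zero hτ hlt s hc).trans
      (val_le_of_abs_le (hac.trans (le_abs_self c)))⟩

theorem asymptoticMap_shiftedDerivation {g : HahnGroup I} (hg : g ≠ 0) :
    asymptoticMap (powerSeriesVal ℝ _) (shiftedDerivation hτ hlt s) g = s - logElt τ g := by
  -- The monomial `t^g` shows that a value exists; it depends only on `g`, so the chosen one is the
  -- expected one.
  obtain ⟨a, ha, h⟩ := Classical.epsilon_spec (p := fun h : HahnGroup I =>
    ∃ a : PowerSeriesField ℝ (HahnGroup I), powerSeriesVal ℝ _ a = (g : WithTop (HahnGroup I)) ∧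
      powerSeriesVal ℝ _ (shiftedDerivation hτ hlt s a / a) = (h : WithTop (HahnGroup I)))
    ⟨_, _, val_single g one_ne_zero,
      val_logDeriv_shiftedDerivation hτ hlt s (val_single g one_ne_zero) hg⟩
  rw [val_logDeriv_shiftedDerivation hτ hlt s ha hg] at h
  exact (WithTop.coe_injective h).symm

theorem isHardyTypeDerivation_shiftedDerivation :
    IsHardyTypeDerivation (powerSeriesVal ℝ _) (shiftedDerivation hτ hlt s) where
  hardyType := isHardyTypeCouple_of_logElt hτ hlt s fun _ hg =>
    asymptoticMap_shiftedDerivation hτ hlt s hg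
  ph1 a b ha hb hb0 := by
    obtain ⟨g, hg⟩ := exists_val_eq hb0
    have hg0 : g ≠ 0 := by
      rintro rfl
      exact hb.ne' hg
    rw [val_logDeriv_shiftedDerivation hτ hlt s hg hg0]
    -- Removing the constant term does not change `D a`; for the remainder in the maximal ideal the
    -- claim is `ac3`.
    set m := a - toLex (HahnSeries.C ((ofLex a).coeff 0)) with hm
    have hmpos : 0 < powerSeriesVal ℝ _ m := zero_lt_val_sub_const ha
    have hD : shiftedDerivation hτ hlt s a = shiftedDerivation hτ hlt s m := by
      rw [hm, map_sub, shiftedDerivation_const, sub_zero]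
    rw [hD]
    obtain hm0 | hm0 := eq_or_ne m 0
    · rw [hm0, map_zero, AddValuation.map_zero]
      exact WithTop.coe_lt_top _
    obtain ⟨h, hh⟩ := exists_val_eq hm0
    rw [hh] at hmpos
    have hhpos : 0 < h := by exact_mod_cast hmpos
    rw [val_shiftedDerivation hτ hlt s hh hhpos.ne', WithTop.coe_lt_coe]
    have := (isHardyTypeCouple_of_logElt hτ hlt s (ψ := fun g => s - logElt τ g)
      fun _ _ => rfl).ac3 g h hg0 hhpos.ne'
    rwa [abs_of_pos hhpos] at this
  ph2 := by
    refine ⟨fun x hx y hy z hz => ?_⟩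
    rw [SetLike.mem_coe, mem_valRing_iff_exists_const hτ hlt s] at *
    obtain ⟨c, hc, hxc⟩ := hx
    obtain ⟨d, hd, hyd⟩ := hy
    refine ⟨c + d, by rw [map_add, hc, hd, add_zero], abs_le.2 ⟨?_, ?_⟩⟩
    · linarith [neg_abs_le x, hz.1, (abs_nonneg y).trans hyd]
    · linarith [le_abs_self y, hz.2, (abs_nonneg x).trans hxc]
  ph3 a ha := by
    have ha0 : 0 < a := ha 0 (zero_mem _)
    obtain ⟨g, hg⟩ := exists_val_eq ha0.ne'
    have hg0 : g < 0 := by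
      by_contra! hc
      refine (ha a ?_).false
      change 0 ≤ powerSeriesVal ℝ _ a
      rw [hg]
      exact_mod_cast hc
    have hneg : (toLex (single s (-1)) : PowerSeriesField ℝ (HahnGroup I)) < 0 := by
      rw [← leadingCoeff_neg_iff, ofLex_toLex, leadingCoeff_of_single]
      norm_num
    rw [shiftedDerivation_apply]
    exact mul_pos_of_neg_of_neg hneg (hahnDerivation_neg hτ hlt hg hg0 ha0)
  mem_valRing_iff _ := mem_valRing_iff_exists_const hτ hlt s
  h2 a ha := ⟨_, _, shiftedDerivation_const hτ hlt s _, zero_lt_val_sub_const ha,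
    (add_sub_cancel _ a).symm⟩

end

end HardyDerivation

/-! ### Principal ranks of the group -/

theorem groupPrincipalRank_congr {G : Type*} [AddCommGroup G] [LinearOrder G] {dom : Set G}
    {φ φ' : G → G} (h : Set.EqOn φ φ' dom) :
    groupPrincipalRank dom φ = groupPrincipalRank dom φ' := by
  have : compatibleSubgroups dom φ = compatibleSubgroups dom φ' := by
    ext H
    refine and_congr_right fun _ => forall₂_congr fun a ha => ?_
    rw [h ha]
  rw [groupPrincipalRank, groupPrincipalRank, this]

theorem mem_of_abs_le_abs {G : Type*} [AddCommGroup G] [LinearOrder G] [IsOrderedAddMonoid G]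
    {H : AddSubgroup G} (hH : (H : Set G).OrdConnected) {x y : G} (hy : y ∈ H) (h : |x| ≤ |y|) :
    x ∈ H := by
  have hy' : |y| ∈ H := abs_mem_iff.2 hy
  exact hH.out (H.neg_mem hy') hy' (abs_le.1 h)

/-! ### ### Cuts and log-closed convex subgroups -/

section Cut

open HahnGroup

variable (Q : Type*)

/-- The index set of the Hahn group: each element of `Q` contributes a copy of `ℤ`, and larger
elements of `Q` contribute smaller indices, that is larger archimedean classes. -/
abbrev CutIndex : Type _ := Qᵒᵈ ×ₗ ℤ

variable {Q}

/-- The successor map on the copies of `ℤ`. -/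
def indexSucc (i : CutIndex Q) : CutIndex Q := toLex ((ofLex i).1, (ofLex i).2 + 1)

/-- The `n`-th index belonging to `q`. -/
def indexAt (q : Q) (n : ℤ) : CutIndex Q := toLex (OrderDual.toDual q, n)

theorem exists_eq_indexAt (i : CutIndex Q) : ∃ q n, i = indexAt q n := ⟨_, _, rfl⟩

theorem indexSucc_indexAt (q : Q) (n : ℤ) : indexSucc (indexAt q n) = indexAt q (n + 1) := rfl

variable [LinearOrder Q]

theorem indexAt_lt_indexAt {q q' : Q} {n n' : ℤ} :
    indexAt q n < indexAt q' n' ↔ q' < q ∨ q = q' ∧ n < n' := by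
  simp [indexAt, Prod.Lex.toLex_lt_toLex]

theorem indexSucc_strictMono : StrictMono (indexSucc : CutIndex Q → CutIndex Q) := by
  intro i j h
  obtain ⟨q, n, rfl⟩ := exists_eq_indexAt i
  obtain ⟨q', n', rfl⟩ := exists_eq_indexAt j
  simpa [indexSucc_indexAt, indexAt_lt_indexAt] using h

theorem lt_indexSucc (i : CutIndex Q) : i < indexSucc i := by
  obtain ⟨q, n, rfl⟩ := exists_eq_indexAt i
  simp [indexSucc_indexAt, indexAt_lt_indexAt]

/-- The convex subgroup of the elements supported on indices which belong to some `p ≤ q`. -/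
def cut (q : Q) : AddSubgroup (HahnGroup (CutIndex Q)) where
  carrier := {g | ∀ p n, q < p → (ofLex g).coeff (indexAt p n) = 0}
  zero_mem' _ _ _ := rfl
  add_mem' {a b} ha hb p n hp := by
    have : (ofLex (a + b)).coeff (indexAt p n) =
      (ofLex a).coeff (indexAt p n) + (ofLex b).coeff (indexAt p n) := rfl
    rw [this, ha p n hp, hb p n hp, add_zero]
  neg_mem' {a} ha p n hp := by
    have : (ofLex (-a)).coeff (indexAt p n) = -(ofLex a).coeff (indexAt p n) := rfl
    rw [this, ha p n hp, neg_zero]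

theorem mem_cut_iff {q p : Q} {n : ℤ} {g : HahnGroup (CutIndex Q)}
    (hg : (ofLex g).orderTop = indexAt p n) : g ∈ cut q ↔ p ≤ q := by
  constructor
  · intro h
    by_contra! hc
    exact coeff_orderTop_ne hg (h p n hc)
  · intro h p' n' hp'
    apply coeff_eq_zero_of_lt_orderTop
    rw [hg, WithTop.coe_lt_coe, indexAt_lt_indexAt]
    exact Or.inl (h.trans_lt hp')

theorem basis_mem_cut_iff {q p : Q} {n : ℤ} : basis (indexAt p n) ∈ cut q ↔ p ≤ q :=
  mem_cut_iff (orderTop_basis _)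

theorem cut_le_cut_iff {p q : Q} : cut p ≤ cut q ↔ p ≤ q :=
  ⟨fun h => basis_mem_cut_iff.1 (h (basis_mem_cut_iff.2 le_rfl : basis (indexAt p 0) ∈ cut p)),
    fun h _ hg p' n hp' => hg p' n (h.trans_lt hp')⟩

theorem cut_ne_bot (q : Q) : cut q ≠ ⊥ := fun h => by
  have : basis (indexAt q 0) ∈ cut q := basis_mem_cut_iff.2 le_rfl
  rw [h, AddSubgroup.mem_bot] at this
  exact (basis_pos _).ne' this

theorem cut_ordConnected (q : Q) : (cut q : Set (HahnGroup (CutIndex Q))).OrdConnected := by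
  have hpos {x y : HahnGroup (CutIndex Q)} (hy : y ∈ cut q) (hx : 0 ≤ x) (hxy : x ≤ y) :
      x ∈ cut q := by
    obtain rfl | hx0 := hx.eq_or_lt
    · exact zero_mem _
    obtain ⟨i, hi⟩ := exists_orderTop_eq hx0.ne'
    obtain ⟨j, hj⟩ := exists_orderTop_eq (hx0.trans_le hxy).ne'
    obtain ⟨p, n, rfl⟩ := exists_eq_indexAt i
    obtain ⟨p', n', rfl⟩ := exists_eq_indexAt j
    have hle := orderTop_le_of_abs_le
      (by rwa [abs_of_nonneg hx, abs_of_nonneg (hx.trans hxy)] : |x| ≤ |y|)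
    rw [hi, hj, WithTop.coe_le_coe, ← not_lt, indexAt_lt_indexAt, not_or, not_lt] at hle
    rw [mem_cut_iff hj] at hy
    exact (mem_cut_iff hi).2 (hle.1.trans hy)
  refine ⟨fun x hx y hy z hz => ?_⟩
  have := hpos (sub_mem hy hx) (sub_nonneg.2 hz.1) (sub_le_sub_right hz.2 x)
  simpa using add_mem this hx

/-- `H` is closed under taking and undoing logarithms. -/
def IsLogClosed (H : AddSubgroup (HahnGroup (CutIndex Q))) : Prop :=
  ∀ h, h ≠ 0 → (h ∈ H ↔ logElt indexSucc h ∈ H)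

theorem isLogClosed_cut (q : Q) : IsLogClosed (cut q) := by
  intro h hh
  obtain ⟨i, hi⟩ := exists_orderTop_eq hh
  obtain ⟨p, n, rfl⟩ := exists_eq_indexAt i
  rw [mem_cut_iff hi, logElt_eq _ hi, indexSucc_indexAt, basis_mem_cut_iff]

/-- Undoing logarithms lowers the `ℤ`-coordinate by one each time, and the resulting basis elements
are cofinal in `cut q`; convexity then gives everything. -/
theorem cut_le_of_mem {H : AddSubgroup (HahnGroup (CutIndex Q))}
    (hH : (H : Set (HahnGroup (CutIndex Q))).OrdConnected) (hlog : IsLogClosed H)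
    {x : HahnGroup (CutIndex Q)} {q : Q} {n : ℤ} (hx : x ∈ H)
    (hxq : (ofLex x).orderTop = indexAt q n) : cut q ≤ H := by
  -- The descent starts at `n + 1` because the logarithm of `x` is a basis element, while `x` need
  -- not be.
  have hstep (k : ℕ) : basis (indexAt q (n + 1 - k)) ∈ H := by
    induction k with
    | zero =>
      have := (hlog x (ne_zero_of_orderTop hxq)).1 hx
      simpa [logElt_eq _ hxq, indexSucc_indexAt] using this
    | succ k ih =>
      rw [hlog _ (basis_pos _).ne', logElt_eq _ (orderTop_basis _), indexSucc_indexAt]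
      convert! ih using 3
      push_cast
      ring
  intro y hy
  obtain rfl | hy0 := eq_or_ne y 0
  · exact zero_mem _
  obtain ⟨i, hi⟩ := exists_orderTop_eq hy0
  obtain ⟨p, m, rfl⟩ := exists_eq_indexAt i
  rw [mem_cut_iff hi] at hy
  obtain ⟨k, hk⟩ : ∃ k : ℕ, n + 1 - k < m := ⟨(n + 2 - m).toNat, by omega⟩
  refine mem_of_abs_le_abs hH (hstep k) (abs_lt_abs_of_orderTop_ofLex ?_).le
  rw [orderTop_basis, hi, WithTop.coe_lt_coe, indexAt_lt_indexAt]
  exact hy.lt_or_eq.imp_right fun h => ⟨h.symm, hk⟩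

/-- A nonzero `h` in `H` has its logarithm in `H` by convexity, so compatibility forces `s` into
`H`. The trivial subgroup offers no such `h` and is excluded. -/
theorem mem_compatibleSubgroups_iff {s : HahnGroup (CutIndex Q)}
    {H : AddSubgroup (HahnGroup (CutIndex Q))} (hne : H ≠ ⊥) :
    H ∈ compatibleSubgroups {h | h ≠ 0} (fun h => s - logElt indexSucc h) ↔
      (H : Set (HahnGroup (CutIndex Q))).OrdConnected ∧ IsLogClosed H ∧ s ∈ H := by
  refine and_congr_right fun hH => ⟨fun hc => ?_, fun ⟨hlog, hs⟩ h hh => ?_⟩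
  · obtain ⟨h, hhH, hh⟩ := H.bot_or_exists_ne_zero.resolve_left hne
    have h1 : s - logElt indexSucc h ∈ H := (hc h hh).1 hhH
    have h2 : logElt indexSucc h ∈ H := by
      refine mem_of_abs_le_abs hH hhH ?_
      rw [abs_of_pos (logElt_pos _ hh)]
      exact (logElt_lt_abs lt_indexSucc hh).le
    have hs : s ∈ H := by simpa using add_mem h1 h2
    refine ⟨fun g hg => (hc g hg).trans ?_, hs⟩
    exact ⟨fun h => by simpa using sub_mem hs h, fun h => sub_mem hs h⟩
  · refine (hlog h hh).trans ?_
    exact ⟨fun h => sub_mem hs h, fun h => by simpa using sub_mem hs h⟩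

theorem groupPrincipalRank_eq (s : HahnGroup (CutIndex Q)) :
    groupPrincipalRank {h | h ≠ 0} (fun h => s - logElt indexSucc h) =
      {H | ∃ q, s ∈ cut q ∧ cut q = H} := by
  have hcut (q : Q) (hs : s ∈ cut q) :
      cut q ∈ compatibleSubgroups {h | h ≠ 0} (fun h => s - logElt indexSucc h) :=
    (mem_compatibleSubgroups_iff (cut_ne_bot q)).2 ⟨cut_ordConnected q, isLogClosed_cut q, hs⟩
  ext H
  constructor
  · rintro ⟨hne, x, ⟨hHc, hxH⟩, hleast⟩
    obtain ⟨hH, hlog, hsH⟩ := (mem_compatibleSubgroups_iff hne).1 hHc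
    -- Here `z` will be whichever of `x` and `s` has its leading index in the copy of the larger
    -- element of `Q`.
    suffices h : ∃ z q n, z ∈ H ∧ (ofLex z).orderTop = indexAt q n ∧ s ∈ cut q ∧ x ∈ cut q by
      obtain ⟨z, q, n, hz, hzq, hs, hx⟩ := h
      exact ⟨q, hs, le_antisymm (cut_le_of_mem hH hlog hz hzq) (hleast ⟨hcut q hs, hx⟩)⟩
    obtain rfl | hx0 := eq_or_ne x 0
    · obtain rfl | hs0 := eq_or_ne s 0
      -- For `x = s = 0` the trivial subgroup is itself compatible, as logarithms never vanish.
      · refine absurd (le_bot_iff.1 (hleast ⟨⟨?_, fun h hh => ?_⟩, zero_mem _⟩)) hne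
        · simpa using Set.ordConnected_singleton
        · simp [show h ≠ 0 from hh, (logElt_pos indexSucc hh).ne']
      · obtain ⟨i, hi⟩ := exists_orderTop_eq hs0
        obtain ⟨q, n, rfl⟩ := exists_eq_indexAt i
        exact ⟨s, q, n, hsH, hi, (mem_cut_iff hi).2 le_rfl, zero_mem _⟩
    · obtain ⟨i, hi⟩ := exists_orderTop_eq hx0
      obtain ⟨q, n, rfl⟩ := exists_eq_indexAt i
      by_cases hsq : s ∈ cut q
      · exact ⟨x, q, n, hxH, hi, hsq, (mem_cut_iff hi).2 le_rfl⟩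
      · have hs0 : s ≠ 0 := by
          rintro rfl
          exact hsq (zero_mem _)
        obtain ⟨j, hj⟩ := exists_orderTop_eq hs0
        obtain ⟨p, m, rfl⟩ := exists_eq_indexAt j
        rw [mem_cut_iff hj, not_le] at hsq
        exact ⟨s, p, m, hsH, hj, (mem_cut_iff hj).2 le_rfl, (mem_cut_iff hi).2 hsq.le⟩
  · rintro ⟨q, hs, rfl⟩
    have hmem : basis (indexAt q 0) ∈ cut q := basis_mem_cut_iff.2 le_rfl
    refine ⟨cut_ne_bot q, basis (indexAt q 0), ⟨hcut q hs, hmem⟩, fun F ⟨hF, hxF⟩ => ?_⟩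
    have hFne : F ≠ ⊥ := by
      rintro rfl
      exact (basis_pos _).ne' (AddSubgroup.mem_bot.1 hxF)
    obtain ⟨hF1, hF2, -⟩ := (mem_compatibleSubgroups_iff hFne).1 hF
    exact cut_le_of_mem hF1 hF2 hxF (orderTop_basis _)

theorem groupPrincipalUnfoldedRank_eq {s : HahnGroup (CutIndex Q)}
    {ψ : HahnGroup (CutIndex Q) → HahnGroup (CutIndex Q)}
    (hψ : ∀ g, g ≠ 0 → ψ g = s - logElt indexSucc g) :
    groupPrincipalUnfoldedRank ψ = Set.range (cut : Q → _) := by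
  have hg (g : HahnGroup (CutIndex Q)) (hg : g ≠ 0) :
      groupPrincipalRank {h | h ≠ 0} (fun h => ψ h - ψ g) =
        {H | ∃ q, logElt indexSucc g ∈ cut q ∧ cut q = H} := by
    rw [← groupPrincipalRank_eq]
    refine groupPrincipalRank_congr fun h hh => ?_
    simp only [hψ h hh, hψ g hg]
    abel
  ext H
  simp only [groupPrincipalUnfoldedRank, Set.mem_iUnion, Set.mem_range]
  constructor
  · rintro ⟨g, hg0, hH⟩
    rw [hg g hg0] at hH
    exact hH.imp fun q h => h.2
  · rintro ⟨q, rfl⟩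
    refine ⟨basis (indexAt q 0), (basis_pos _).ne', ?_⟩
    rw [hg _ (basis_pos _).ne']
    refine ⟨q, ?_, rfl⟩
    rw [logElt_eq _ (orderTop_basis _), indexSucc_indexAt, basis_mem_cut_iff]

end Cut

/-! ### Coarsenings and convex subgroups -/

section Coarsening

variable {K : Type*} [Field K] {G : Type*} [AddCommGroup G] [LinearOrder G] [IsOrderedAddMonoid G]
  {v : AddValuation K (WithTop G)}

theorem mem_valRing {a : K} : a ∈ valRing v ↔ 0 ≤ v a := Iff.rfl

theorem mem_unitSet {w : ValuationSubring K} {a : K} :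
    a ∈ unitSet w ↔ a ∈ w ∧ a⁻¹ ∈ w ∧ a ≠ 0 := by
  rw [unitSet, Set.mem_ofPred_eq]
  obtain rfl | ha := eq_or_ne a 0
  · simp
  have hpos : 0 < w.valuation a := zero_lt_iff.2 ((Valuation.ne_zero_iff _).2 ha)
  rw [← w.valuation_le_one_iff, ← w.valuation_le_one_iff, map_inv₀, inv_le_one₀ hpos]
  exact ⟨fun h => ⟨h.le, h.ge, ha⟩, fun h => le_antisymm h.1 h.2.1⟩

theorem exists_coe_eq_val {a : K} (ha : a ≠ 0) : ∃ g : G, v a = g :=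
  (WithTop.ne_top_iff_exists.1 ((AddValuation.ne_top_iff v).2 ha)).imp fun _ h => h.symm

theorem ne_zero_of_val_eq_coe {a : K} {g : G} (h : v a = g) : a ≠ 0 := by
  rintro rfl
  simp at h

theorem val_inv_eq {a : K} {g : G} (h : v a = g) : v a⁻¹ = (-g : G) := by
  rw [AddValuation.map_inv, h]
  rfl

theorem div_mem_of_val_le {w : ValuationSubring K} (hw : valRing v ≤ w) {a b : K} {g h : G}
    (ha : v a = g) (hb : v b = h) (hle : h ≤ g) : a / b ∈ w := by
  apply hw
  rw [mem_valRing, div_eq_mul_inv, AddValuation.map_mul, ha, val_inv_eq hb, ← WithTop.coe_add]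
  exact_mod_cast (by simpa using hle : 0 ≤ g + -h)

variable (v)

/-- The coarsening of `v` with valuation ring `{a | ∃ h ∈ H, h ≤ v a}`. -/
def coarsening (H : AddSubgroup G) : ValuationSubring K where
  carrier := {a | ∃ h ∈ H, (h : WithTop G) ≤ v a}
  mul_mem' := by
    rintro a b ⟨g, hg, ha⟩ ⟨h, hh, hb⟩
    refine ⟨g + h, add_mem hg hh, ?_⟩
    rw [AddValuation.map_mul, WithTop.coe_add]
    exact add_le_add ha hb
  one_mem' := ⟨0, zero_mem _, by simp⟩
  add_mem' := by
    rintro a b ⟨g, hg, ha⟩ ⟨h, hh, hb⟩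
    obtain hgh | hgh := le_total g h
    · exact ⟨g, hg, (le_min ha ((WithTop.coe_le_coe.2 hgh).trans hb)).trans (v.map_add a b)⟩
    · exact ⟨h, hh, (le_min ((WithTop.coe_le_coe.2 hgh).trans ha) hb).trans (v.map_add a b)⟩
  zero_mem' := ⟨0, zero_mem _, by simp⟩
  neg_mem' := by
    rintro a ⟨g, hg, ha⟩
    exact ⟨g, hg, by rwa [AddValuation.map_neg]⟩
  mem_or_inv_mem' a :=
    ((valRing v).mem_or_inv_mem a).imp (fun h => ⟨0, zero_mem _, h⟩) fun h => ⟨0, zero_mem _, h⟩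

/-- The subgroup of the values of the units of a coarsening of `v`. -/
def unitValues (w : ValuationSubring K) : AddSubgroup G where
  carrier := coarseningGroup v w
  zero_mem' := ⟨1, mem_unitSet.2 ⟨one_mem _, by simp, one_ne_zero⟩, by simp⟩
  add_mem' := by
    rintro g h ⟨a, ha, hg⟩ ⟨b, hb, hh⟩
    rw [mem_unitSet] at ha hb
    refine ⟨a * b, mem_unitSet.2 ⟨mul_mem ha.1 hb.1, ?_, mul_ne_zero ha.2.2 hb.2.2⟩, ?_⟩
    · rw [mul_inv]
      exact mul_mem ha.2.1 hb.2.1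
    · rw [AddValuation.map_mul, hg, hh, WithTop.coe_add]
  neg_mem' := by
    rintro g ⟨a, ha, hg⟩
    rw [mem_unitSet] at ha
    exact ⟨a⁻¹, mem_unitSet.2 ⟨ha.2.1, by rw [inv_inv]; exact ha.1, inv_ne_zero ha.2.2⟩,
      val_inv_eq hg⟩

variable {v}

theorem valRing_le_coarsening (H : AddSubgroup G) : valRing v ≤ coarsening v H :=
  fun _ ha => ⟨0, zero_mem _, ha⟩

theorem coarsening_mono {H H' : AddSubgroup G} (h : H ≤ H') : coarsening v H ≤ coarsening v H' :=
  fun _ ⟨g, hg, ha⟩ => ⟨g, h hg, ha⟩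

theorem coarsening_bot : coarsening v ⊥ = valRing v := by
  refine le_antisymm (fun a ⟨g, hg, ha⟩ => ?_) (valRing_le_coarsening _)
  rw [AddSubgroup.mem_bot] at hg
  subst hg
  exact ha

/-- Elements of equal value differ by a unit of `valRing v`, which is a unit of `w`. -/
theorem mem_unitSet_iff_mem_unitValues {w : ValuationSubring K} (hw : valRing v ≤ w) {a : K} {g : G}
    (ha : v a = g) : a ∈ unitSet w ↔ g ∈ unitValues v w := by
  refine ⟨fun h => ⟨a, h, ha⟩, fun ⟨b, hb, hg⟩ => ?_⟩
  rw [mem_unitSet] at hb ⊢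
  refine ⟨?_, ?_, ne_zero_of_val_eq_coe ha⟩
  · simpa [hb.2.2] using mul_mem (div_mem_of_val_le hw ha hg le_rfl) hb.1
  · simpa [div_mul_eq_mul_div, hb.2.2] using mul_mem (div_mem_of_val_le hw hg ha le_rfl) hb.2.1

theorem unitValues_mono {w w' : ValuationSubring K} (h : w ≤ w') :
    unitValues v w ≤ unitValues v w' := by
  rintro g ⟨a, ha, hg⟩
  rw [mem_unitSet] at ha
  exact ⟨a, mem_unitSet.2 ⟨h ha.1, h ha.2.1, ha.2.2⟩, hg⟩

theorem unitValues_ordConnected (hv : ∀ g : G, ∃ a : K, v a = g) {w : ValuationSubring K}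
    (hw : valRing v ≤ w) : (unitValues v w : Set G).OrdConnected := by
  refine ⟨?_⟩
  rintro x ⟨a, ha, hx⟩ y ⟨b, hb, hy⟩ z ⟨hxz, hzy⟩
  obtain ⟨c, hc⟩ := hv z
  rw [mem_unitSet] at ha hb
  refine ⟨c, mem_unitSet.2 ⟨?_, ?_, ne_zero_of_val_eq_coe hc⟩, hc⟩
  · simpa [ha.2.2] using mul_mem (div_mem_of_val_le hw hc hx hxz) ha.1
  · simpa [div_mul_eq_mul_div, hb.2.2] using mul_mem (div_mem_of_val_le hw hy hc hzy) hb.2.1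

theorem coarsening_unitValues {w : ValuationSubring K} (hw : valRing v ≤ w) :
    coarsening v (unitValues v w) = w := by
  refine le_antisymm ?_ fun a ha => ?_
  · rintro a ⟨g, ⟨b, hb, hg⟩, hle⟩
    obtain rfl | ha0 := eq_or_ne a 0
    · exact zero_mem _
    obtain ⟨h, hh⟩ := exists_coe_eq_val (v := v) ha0
    rw [hh, WithTop.coe_le_coe] at hle
    rw [mem_unitSet] at hb
    simpa [hb.2.2] using mul_mem (div_mem_of_val_le hw hh hg hle) hb.1
  · obtain h0 | h0 := le_or_gt 0 (v a)
    · exact valRing_le_coarsening _ h0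
    have ha0 : a ≠ 0 := by
      rintro rfl
      simp at h0
    obtain ⟨g, hg⟩ := exists_coe_eq_val (v := v) ha0
    refine ⟨g, ⟨a, mem_unitSet.2 ⟨ha, hw ?_, ha0⟩, hg⟩, hg.ge⟩
    rw [mem_valRing, val_inv_eq hg]
    rw [hg] at h0
    exact_mod_cast (neg_nonneg.2 (by exact_mod_cast h0.le) : 0 ≤ -g)

theorem unitValues_coarsening (hv : ∀ g : G, ∃ a : K, v a = g) {H : AddSubgroup G}
    (hH : (H : Set G).OrdConnected) : unitValues v (coarsening v H) = H := by
  ext g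
  constructor
  · rintro ⟨a, ha, hg⟩
    obtain ⟨⟨h, hh, hle⟩, ⟨h', hh', hle'⟩, -⟩ := mem_unitSet.1 ha
    rw [hg, WithTop.coe_le_coe] at hle
    rw [val_inv_eq hg, WithTop.coe_le_coe] at hle'
    exact hH.out hh (neg_mem hh') ⟨hle, le_neg.1 hle'⟩
  · intro hg
    obtain ⟨a, ha⟩ := hv g
    exact ⟨a, mem_unitSet.2 ⟨⟨g, hg, ha.ge⟩, ⟨-g, neg_mem hg, (val_inv_eq ha).ge⟩,
      ne_zero_of_val_eq_coe ha⟩, ha⟩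

theorem isCompatible_unitSet_iff (hv : ∀ g : G, ∃ a : K, v a = g) {φ : K → K} {ψ : G → G}
    (hφ : ∀ (a : K) (g : G), v a = g → g ≠ 0 → v (φ a) = ψ g) {w : ValuationSubring K}
    (hw : valRing v ≤ w) :
    IsCompatible {a : K | a ≠ 0 ∧ v a ≠ 0} φ (unitSet w) ↔
      IsCompatible {g : G | g ≠ 0} ψ (unitValues v w : Set G) := by
  constructor
  · intro h g hg
    obtain ⟨a, ha⟩ := hv g
    have := h a ⟨ne_zero_of_val_eq_coe ha, by rw [ha]; exact_mod_cast hg⟩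
    rwa [mem_unitSet_iff_mem_unitValues hw ha,
      mem_unitSet_iff_mem_unitValues hw (hφ a g ha hg)] at this
  · rintro h a ⟨ha0, ha⟩
    obtain ⟨g, hg⟩ := exists_coe_eq_val (v := v) ha0
    have hg0 : g ≠ 0 := by
      rintro rfl
      exact ha hg
    rw [mem_unitSet_iff_mem_unitValues hw hg, mem_unitSet_iff_mem_unitValues hw (hφ a g hg hg0)]
    exact h g hg0

/-- `coarsening` and `unitValues` are mutually inverse on coarsenings and convex subgroups and
preserve compatibility. Only the generators need translating. -/
theorem fieldPrincipalRank_eq (hv : ∀ g : G, ∃ a : K, v a = g) {φ : K → K} {ψ : G → G}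
    (hφ : ∀ (a : K) (g : G), v a = g → g ≠ 0 → v (φ a) = ψ g) :
    fieldPrincipalRank v {a : K | a ≠ 0 ∧ v a ≠ 0} φ =
      coarsening v '' groupPrincipalRank {g : G | g ≠ 0} ψ := by
  have hcoarse {H : AddSubgroup G} (hH : H ∈ compatibleSubgroups {g : G | g ≠ 0} ψ) :
      coarsening v H ∈ compatibleCoarsenings v {a : K | a ≠ 0 ∧ v a ≠ 0} φ := by
    refine ⟨valRing_le_coarsening H, ?_⟩
    rw [isCompatible_unitSet_iff hv hφ (valRing_le_coarsening H), unitValues_coarsening hv hH.1]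
    exact hH.2
  have hvalues {w : ValuationSubring K}
      (hw : w ∈ compatibleCoarsenings v {a : K | a ≠ 0 ∧ v a ≠ 0} φ) :
      unitValues v w ∈ compatibleSubgroups {g : G | g ≠ 0} ψ :=
    ⟨unitValues_ordConnected hv hw.1, (isCompatible_unitSet_iff hv hφ hw.1).1 hw.2⟩
  ext w
  constructor
  · rintro ⟨hne, a, ⟨hw, ha⟩, hleast⟩
    have hcw := coarsening_unitValues hw.1
    refine ⟨unitValues v w, ⟨?_, ?_⟩, hcw⟩
    · intro h
      rw [h, coarsening_bot] at hcw
      exact hne hcw.symm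
    · rw [← hcw] at ha
      obtain ⟨g, hg, hga⟩ := ha
      -- If `0 ≤ v a`, then `a` lies in every coarsening and the generator is `0`; otherwise it is
      -- `v a`.
      obtain h0 | h0 := le_or_gt 0 (v a)
      · refine ⟨0, ⟨hvalues hw, zero_mem _⟩, fun F ⟨hF, _⟩ => ?_⟩
        rw [← unitValues_coarsening hv hF.1]
        exact unitValues_mono (hleast ⟨hcoarse hF, valRing_le_coarsening F h0⟩)
      · have ha0 : a ≠ 0 := by
          rintro rfl
          simp at h0
        obtain ⟨k, hk⟩ := exists_coe_eq_val (v := v) ha0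
        rw [hk] at h0 hga
        refine ⟨k, ⟨hvalues hw, ?_⟩, fun F ⟨hF, hkF⟩ => ?_⟩
        · exact (unitValues_ordConnected hv hw.1).out hg (zero_mem _)
            ⟨by exact_mod_cast hga, by exact_mod_cast h0.le⟩
        · rw [← unitValues_coarsening hv hF.1]
          exact unitValues_mono (hleast ⟨hcoarse hF, k, hkF, hk.ge⟩)
  · rintro ⟨H, ⟨hne, g, ⟨hH, hg⟩, hleast⟩, rfl⟩
    have hval := unitValues_coarsening hv hH.1
    refine ⟨fun h => hne ?_, ?_⟩
    · rw [← hval, h, ← coarsening_bot, unitValues_coarsening hv]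
      simpa using Set.ordConnected_singleton
    -- The value must be nonpositive for membership of `a` in a coarsening to force `g` into its
    -- subgroup.
    · obtain ⟨a, ha⟩ := hv (-|g|)
      refine ⟨a, ⟨hcoarse hH, -|g|, neg_mem (abs_mem_iff.2 hg), ha.ge⟩, fun u ⟨hu, hau⟩ => ?_⟩
      rw [← coarsening_unitValues hu.1] at hau ⊢
      refine coarsening_mono (hleast ⟨hvalues hu, ?_⟩)
      obtain ⟨k, hk, hka⟩ := hau
      rw [ha, WithTop.coe_le_coe] at hka
      refine mem_of_abs_le_abs (unitValues_ordConnected hv hu.1) hk ?_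
      exact (le_neg.1 hka).trans (neg_le_abs k)

theorem coarsening_le_coarsening_iff (hv : ∀ g : G, ∃ a : K, v a = g) {H H' : AddSubgroup G}
    (hH : (H : Set G).OrdConnected) (hH' : (H' : Set G).OrdConnected) :
    coarsening v H ≤ coarsening v H' ↔ H ≤ H' := by
  refine ⟨fun h => ?_, coarsening_mono⟩
  rw [← unitValues_coarsening hv hH, ← unitValues_coarsening hv hH']
  exact unitValues_mono h

end Coarsening
end

end DiffRank

/-! ### ### Realizing prescribed ranks -/

open DiffRank in
theorem exists_hardyTypeDerivation_of_mem_cut {Q : Type u} [LinearOrder Q] (P : Set Q)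
    (s : HahnGroup (CutIndex Q)) (hs : ∀ q, s ∈ cut q ↔ q ∈ P) :
    ∃ D : Derivation ℤ (PowerSeriesField ℝ (HahnGroup (CutIndex Q)))
        (PowerSeriesField ℝ (HahnGroup (CutIndex Q))),
      IsHardyTypeDerivation (powerSeriesVal ℝ _) D ∧
      ∃ (e : Q ≃o principalUnfoldedDifferentialRank (powerSeriesVal ℝ _) D)
        (f : P ≃o principalDifferentialRank (powerSeriesVal ℝ _) D),
        ∀ p : P, ((e (p : Q) : AddSubgroup (HahnGroup (CutIndex Q))) :
          Set (HahnGroup (CutIndex Q))) = coarseningGroup (powerSeriesVal ℝ _)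
            (f p : ValuationSubring (PowerSeriesField ℝ (HahnGroup (CutIndex Q)))) := by
  have hv (g : HahnGroup (CutIndex Q)) :
      ∃ a : PowerSeriesField ℝ (HahnGroup (CutIndex Q)), powerSeriesVal ℝ _ a = g :=
    ⟨_, val_single g one_ne_zero⟩
  have hunf := groupPrincipalUnfoldedRank_eq fun g hg =>
    asymptoticMap_shiftedDerivation indexSucc_strictMono lt_indexSucc s hg
  have hdiff : principalDifferentialRank (powerSeriesVal ℝ (HahnGroup (CutIndex Q)))
      (shiftedDerivation indexSucc_strictMono lt_indexSucc s) =
        Set.range fun p : P => coarsening (powerSeriesVal ℝ _) (cut (p : Q)) := by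
    rw [principalDifferentialRank, fieldPrincipalRank_eq hv fun a g ha hg =>
      val_logDeriv_shiftedDerivation indexSucc_strictMono lt_indexSucc s ha hg,
      groupPrincipalRank_eq]
    ext w
    simp [hs]
  let e₀ : Q ↪o AddSubgroup (HahnGroup (CutIndex Q)) :=
    OrderEmbedding.ofMapLEIff cut fun _ _ => cut_le_cut_iff
  let f₀ : P ↪o ValuationSubring (PowerSeriesField ℝ (HahnGroup (CutIndex Q))) :=
    OrderEmbedding.ofMapLEIff (fun p : P => coarsening (powerSeriesVal ℝ _) (cut (p : Q)))
      fun p q => (coarsening_le_coarsening_iff hv (cut_ordConnected _) (cut_ordConnected _)).trans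
        cut_le_cut_iff
  refine ⟨shiftedDerivation indexSucc_strictMono lt_indexSucc s,
    isHardyTypeDerivation_shiftedDerivation indexSucc_strictMono lt_indexSucc s,
    e₀.orderIso.trans (OrderIso.setCongr _ _ hunf.symm),
    f₀.orderIso.trans (OrderIso.setCongr _ _ hdiff.symm), fun p => ?_⟩
  exact congrArg SetLike.coe (unitValues_coarsening hv (cut_ordConnected (p : Q))).symm

theorem mainTheorem9 {Q : Type u} [LinearOrder Q] (P : Set Q)
    (hP : P = Set.univ ∨ ∃ q : Q, P = Set.Ici q) :
    ∃ (G : Type u) (_ : AddCommGroup G) (_ : LinearOrder G) (_ : IsOrderedAddMonoid G)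
      (D : Derivation ℤ (DiffRank.PowerSeriesField ℝ G) (DiffRank.PowerSeriesField ℝ G)),
      DiffRank.IsHardyTypeDerivation (DiffRank.powerSeriesVal ℝ G) D ∧
      ∃ (e : Q ≃o DiffRank.principalUnfoldedDifferentialRank (DiffRank.powerSeriesVal ℝ G) D)
        (f : P ≃o DiffRank.principalDifferentialRank (DiffRank.powerSeriesVal ℝ G) D),
        ∀ p : P, ((e (p : Q) : AddSubgroup G) : Set G) =
          DiffRank.coarseningGroup (DiffRank.powerSeriesVal ℝ G)
            (f p : ValuationSubring (DiffRank.PowerSeriesField ℝ G)) := by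
  obtain ⟨s, hs⟩ : ∃ s : DiffRank.HahnGroup (DiffRank.CutIndex Q),
      ∀ q, s ∈ DiffRank.cut q ↔ q ∈ P := by
    obtain rfl | ⟨q, rfl⟩ := hP
    -- `0` lies in every cut, whereas `basis (indexAt q 0)` lies exactly in the cuts at `p ≥ q`.
    · exact ⟨0, fun q => by simp [zero_mem]⟩
    · exact ⟨DiffRank.HahnGroup.basis (DiffRank.indexAt q 0), fun p => DiffRank.basis_mem_cut_iff⟩
  exact ⟨_, _, _, _, exists_hardyTypeDerivation_of_mem_cut P s hs⟩
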